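/- Let $\beta>0$ and let $$C_\beta=\{(r,\theta): r\in[0,\infty),\ \theta\in\mathbb R/\beta\mathbb Z\}\big/\big((0,\theta_1)\sim(0,\theta_2)\big)$$ be the infinite cone of angle $\beta$ with the metric $(dr)^2+r^2(d\theta)^2$, area element $d\mathbf x=r\,dr\,d\theta$ and vertex $\mathcal O=\{r=0\}$. For $t>0$ let $H_\beta$ be the heat kernel on $C_\beta$, given by Carslaw's formula $$H_\beta(r,\theta,\rho,\psi;t)=\frac{1}{8\pi\beta i t}\exp\Big\{-\frac{r^2+\rho^2}{4t}\Big\}\int_{A_\theta}\exp\Big\{\frac{r\rho\cos(\alpha-\theta)}{2t}\Big\}\cot\frac{\pi(\alpha-\psi)}{\beta}\,d\alpha ,$$ where $A_\theta$ is the union of two contours in the strip $\theta-\pi\le\Re\alpha\le\theta+\pi$: one in $\Im\alpha>0$, going from $\theta+\pi+i\infty$ to $\theta-\pi+i\infty$, and one in $\Im\alpha<0$, going from $\theta-\pi-i\infty$ to $\theta+\pi-i\infty$. Let $R>0$ and $C_\beta(R)=\{\mathbf x\in C_\beta:\ \mathrm{dist}(\mathbf x,\mathcal O)<R\}$. Then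 $C_\beta(R)$ has finite area, for every $t>0$ the function $\mathbf x\mapsto H_\beta(\mathbf x,\mathbf x;t)$ is integrable over $C_\beta(R)$, and there is an $\epsilon>0$ (which may depend on $\beta$ and $R$) such that $$\int_{C_\beta(R)}H_\beta(\mathbf x,\mathbf x;t)\,d\mathbf x=\frac{\mathrm{Area}(C_\beta(R))}{4\pi t}+\frac1{12}\Big(\frac{2\pi}{\beta}-\frac{\beta}{2\pi}\Big)+O\big(e^{-\epsilon/t}\big)\qquad\text{as } t\to0+ .$$ -/

import Mathlib

open MeasureTheory Set Filter Topology Asymptotics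
open scoped NNReal

noncomputable section

/-! ### The infinite cone of angle `β` -/

/-- The relation on `[0, ∞) × ℝ/βℤ` that identifies all the points with `r = 0`. -/
def coneSetoid (β : ℝ) : Setoid (ℝ≥0 × AddCircle β) where
  r p q := p = q ∨ (p.1 = 0 ∧ q.1 = 0)
  iseqv :=
    { refl := fun _ => Or.inl rfl
      symm := by
        rintro p q (h | ⟨h, h'⟩)
        · exact Or.inl h.symm
        · exact Or.inr ⟨h', h⟩
      trans := by
        rintro p q s (rfl | ⟨h, h'⟩) (rfl | ⟨k, k'⟩)
        · exact Or.inl rfl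
        · exact Or.inr ⟨k, k'⟩
        · exact Or.inr ⟨h, h'⟩
        · exact Or.inr ⟨h, k'⟩ }

/-- The cone `C_β = {(r, θ) : r ∈ [0, ∞), θ ∈ ℝ/βℤ} / (0, θ₁) ∼ (0, θ₂)`. -/
def Cone (β : ℝ) : Type := Quotient (coneSetoid β)

namespace Cone

/-- The quotient σ-algebra. -/
instance instMeasurableSpace (β : ℝ) : MeasurableSpace (Cone β) :=
  inferInstanceAs (MeasurableSpace (Quotient (coneSetoid β)))

/-- The point of the cone with polar coordinates `r ≥ 0` and `θ`. -/
def polar (β : ℝ) (p : ℝ × ℝ) : Cone β :=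
  Quotient.mk (coneSetoid β) (p.1.toNNReal, (p.2 : AddCircle β))

/-- The conical point `r = 0`. -/
def vertex (β : ℝ) : Cone β := polar β (0, 0)

/-- The polar coordinate `r` of a point of the cone. -/
def radius {β : ℝ} (x : Cone β) : ℝ := (Quotient.out x).1

/-- A polar coordinate `θ` of a point of the cone: a real representative of a class modulo `β`
(any class at the vertex). -/
def angle {β : ℝ} (x : Cone β) : ℝ := Quotient.out (Quotient.out x).2

/-- The distance of the metric `dr² + r² dθ²`: the law of cosines for points whose angular
distance in `ℝ/βℤ` is less than `π`, and `r + ρ` (a path through the vertex) otherwise. -/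
def dist {β : ℝ} (x y : Cone β) : ℝ :=
  √(radius x ^ 2 + radius y ^ 2
    - 2 * radius x * radius y * Real.cos (min ‖((angle x - angle y : ℝ) : AddCircle β)‖ Real.pi))

/-- The area measure `r dr dθ` of the metric `dr² + r² dθ²`. -/
def area (β : ℝ) : Measure (Cone β) :=
  (((volume : Measure (ℝ × ℝ)).restrict (Ioi 0 ×ˢ Ico 0 β)).withDensity
    (fun p => ENNReal.ofReal p.1)).map (polar β)

/-- `C_β(R)`, the points at distance less than `R` from the vertex. -/
def disk (β R : ℝ) : Set (Cone β) := {x | dist x (vertex β) < R}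

end Cone

/-! ### The heat kernel -/

/-- The integral of `F` over `A_θ`, the union of two contours: the first goes from `θ + π + i∞` to
`θ - π + i∞` in the upper half of the strip `|Re α - θ| ≤ π`, here down the vertical line
`Re α = θ + π` to height `1`, horizontally, and up the line `Re α = θ - π`; the second goes
from `θ - π - i∞` to `θ + π - i∞` in the lower half of the strip, here up the line
`Re α = θ - π` to height `-1`, horizontally, and down the line `Re α = θ + π`.
The two rays of each contour are put under one integral sign. The integrand of the heat kernel
has no poles off the real axis, so moving the contours within the two half-strips does not change
the value of the kernel. -/
def contourIntegralA (θ : ℝ) (F : ℂ → ℂ) : ℂ :=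
  (Complex.I * (∫ y in Ioi (1 : ℝ),
      (F ((θ - Real.pi : ℝ) + y * Complex.I) - F ((θ + Real.pi : ℝ) + y * Complex.I)))
    - ∫ x in (θ - Real.pi)..(θ + Real.pi), F (x + Complex.I))
  + (Complex.I * (∫ y in Iio (-1 : ℝ),
      (F ((θ - Real.pi : ℝ) + y * Complex.I) - F ((θ + Real.pi : ℝ) + y * Complex.I)))
    + ∫ x in (θ - Real.pi)..(θ + Real.pi), F (x - Complex.I))

/-- The heat kernel `H_β(r, θ, ρ, ψ; t)` on the cone in polar coordinates (Carslaw's formula). -/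
def heatKernelPolar (β r θ ρ ψ t : ℝ) : ℂ :=
  1 / (8 * Real.pi * β * Complex.I * t) * Complex.exp (-(r ^ 2 + ρ ^ 2) / (4 * t)) *
    contourIntegralA θ (fun α =>
      Complex.exp (r * ρ * Complex.cos (α - θ) / (2 * t)) *
        Complex.cot (Real.pi * (α - ψ) / β))

/-- The heat kernel `H_β(x, y; t)` as a function of two points of the cone. -/
def heatKernel (β : ℝ) (x y : Cone β) (t : ℝ) : ℂ :=
  heatKernelPolar β x.radius x.angle y.radius y.angle t

/-! ### The definitions do not depend on the chosen representatives -/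

theorem cot_add_int_mul_pi (z : ℂ) (n : ℤ) : Complex.cot (z + n * Real.pi) = Complex.cot z := by
  have h : Function.Periodic Complex.cot (Real.pi : ℂ) := fun z => by
    simp [Complex.cot_eq_cos_div_sin, Complex.cos_add_pi, Complex.sin_add_pi]
  exact h.int_mul n z

theorem heatKernelPolar_add_right {β : ℝ} (hβ : 0 < β) (r θ ρ ψ t : ℝ) (n : ℤ) :
    heatKernelPolar β r θ ρ (ψ + n * β) t = heatKernelPolar β r θ ρ ψ t := by
  have hb : (β : ℂ) ≠ 0 := by exact_mod_cast hβ.ne'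
  unfold heatKernelPolar
  congr 2
  funext α
  congr 1
  rw [← cot_add_int_mul_pi _ (-n)]
  rw [← cot_add_int_mul_pi (Real.pi * (α - ψ) / β) (-n + -n)]
  congr 1
  push_cast
  field_simp
  ring

theorem contourIntegralA_add (θ c : ℝ) (F : ℂ → ℂ) :
    contourIntegralA (θ + c) F = contourIntegralA θ (fun α => F (α + c)) := by
  unfold contourIntegralA
  have h1 : ∀ w : ℂ, (∫ x in (θ + c - Real.pi)..(θ + c + Real.pi), F (x + w))
      = ∫ x in (θ - Real.pi)..(θ + Real.pi), F (x + w + c) := by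
    intro w
    have := intervalIntegral.integral_comp_add_right (a := θ - Real.pi) (b := θ + Real.pi)
      (fun x : ℝ => F (x + w)) c
    rw [show θ + c - Real.pi = θ - Real.pi + c by ring,
      show θ + c + Real.pi = θ + Real.pi + c by ring, ← this]
    congr 1
    funext x
    congr 1
    push_cast
    ring
  have h2 := h1 Complex.I
  have h3 := h1 (-Complex.I)
  simp only [← sub_eq_add_neg] at h3
  rw [h2, h3]
  have e1 : ∀ y : ℝ, ((θ + c - Real.pi : ℝ) : ℂ) + y * Complex.I
      = (θ - Real.pi : ℝ) + y * Complex.I + c := by intro y; push_cast; ring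
  have e2 : ∀ y : ℝ, ((θ + c + Real.pi : ℝ) : ℂ) + y * Complex.I
      = (θ + Real.pi : ℝ) + y * Complex.I + c := by intro y; push_cast; ring
  simp only [e1, e2]

theorem heatKernelPolar_add_left {β : ℝ} (hβ : 0 < β) (r θ ρ ψ t : ℝ) (n : ℤ) :
    heatKernelPolar β r (θ + n * β) ρ ψ t = heatKernelPolar β r θ ρ ψ t := by
  rw [← heatKernelPolar_add_right hβ r (θ + n * β) ρ ψ t n]
  unfold heatKernelPolar
  rw [contourIntegralA_add]
  congr 2
  funext α
  push_cast
  congr 2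
  · congr 3
    ring
  · congr 1
    ring

namespace Cone

theorem radius_polar {β r : ℝ} (hr : 0 ≤ r) (θ : ℝ) : (polar β (r, θ)).radius = r := by
  have h : (coneSetoid β).r (Quotient.out (polar β (r, θ))) (r.toNNReal, (θ : AddCircle β)) :=
    Quotient.mk_out (s := coneSetoid β) (r.toNNReal, (θ : AddCircle β))
  unfold radius
  rcases h with h | ⟨h, h'⟩
  · rw [h]; exact Real.coe_toNNReal r hr
  · rw [h, ← h']; exact Real.coe_toNNReal r hr

theorem exists_angle_polar {β r : ℝ} (hr : 0 < r) (θ : ℝ) :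
    ∃ n : ℤ, (polar β (r, θ)).angle = θ + n * β := by
  have h : (coneSetoid β).r (Quotient.out (polar β (r, θ))) (r.toNNReal, (θ : AddCircle β)) :=
    Quotient.mk_out (s := coneSetoid β) (r.toNNReal, (θ : AddCircle β))
  rcases h with h | ⟨_, h'⟩
  · have hc : (((polar β (r, θ)).angle : ℝ) : AddCircle β) = (θ : AddCircle β) := by
      unfold angle
      rw [h]
      exact Quotient.out_eq _
    obtain ⟨n, hn⟩ := AddSubgroup.mem_zmultiples_iff.1 ((QuotientAddGroup.eq).1 hc.symm)
    refine ⟨n, ?_⟩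
    rw [← zsmul_eq_mul, hn]
    ring
  · exact absurd (Real.toNNReal_eq_zero.1 h') (not_le.2 hr)

theorem dist_vertex {β : ℝ} (x : Cone β) : dist x (vertex β) = x.radius := by
  have h : (vertex β).radius = 0 := radius_polar le_rfl 0
  have h0 : 0 ≤ x.radius := NNReal.coe_nonneg _
  simp [dist, h, Real.sqrt_sq h0]

end Cone

theorem heatKernel_polar {β r ρ : ℝ} (hβ : 0 < β) (hr : 0 < r) (hρ : 0 < ρ) (θ ψ t : ℝ) :
    heatKernel β (Cone.polar β (r, θ)) (Cone.polar β (ρ, ψ)) t = heatKernelPolar β r θ ρ ψ t := by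
  obtain ⟨m, hm⟩ := Cone.exists_angle_polar (β := β) hr θ
  obtain ⟨n, hn⟩ := Cone.exists_angle_polar (β := β) hρ ψ
  rw [heatKernel, hm, hn, Cone.radius_polar hr.le, Cone.radius_polar hρ.le,
    heatKernelPolar_add_left hβ, heatKernelPolar_add_right hβ]

end

/-! Put `a = π/β`. On the diagonal Carslaw's formula depends on `r` only through `s = r²/(2t)`: it
is `1/(8πβit)` times φ(s), the integral over `A_0` of `cot(az) exp(-s(1 - cos z))`. The area measure
pushes forward to `β r dr`, and `r dr = t ds`, so the integral over the disk is `1/(8πi)` times the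
integral of φ over `(0, S]`, where `S = R²/(2t)`. It remains to find the large-`S` behaviour of that
integral up to an error `O(e^{-cS})`.

Exchanging the integrals in `s` and `z` would replace the exponential by `1/(1 - cos z)`, but on the
original contour `Re(1 - cos z)` is negative near the imaginary axis. By oddness `A_0` is twice its
upper half, and the upper half splits into a corner path around the origin and an outer path on
which `Re(1 - cos z)` is bounded below by a positive constant. The corner path joins antipodal
points, so for an odd function it contributes exactly half a residue (`cornerIntegral_of_odd`). For
the heat integrand this is `πi/a` for every `s`; doubled and integrated over `(0, S]`, it gives the
area term.

On the outer path Fubini is legitimate (`expIntegrates_integral`), and the limit is the outer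
integral of `cot(az)/(1 - cos z)`. That weight decays towards `+i∞`, so its whole upper contour
integral vanishes by Cauchy, and the outer part is minus the corner part, again half a residue, now
at a triple pole: `1/(6a) - 2a/3`. Multiplying `-2πi(1/(6a) - 2a/3)` by `1/(8πi)` gives `(1/12)(2π/β
- β/(2π))`. -/

/-! ### Exponentially convergent integrals of superpositions of exponentials -/

/-- `φ` is integrable on bounded intervals and `∫₀^S φ` tends to `ℓ` exponentially fast. -/
def ExpIntegrates (φ : ℝ → ℂ) (ℓ : ℂ) : Prop :=
  (∀ S, 0 < S → IntegrableOn φ (Ioc 0 S)) ∧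
    ∃ c, 0 < c ∧ ∃ C, ∀ S, 0 < S → ‖(∫ s in Ioc 0 S, φ s) - ℓ‖ ≤ C * Real.exp (-c * S)

theorem ExpIntegrates.congr {φ ψ : ℝ → ℂ} {ℓ m : ℂ} (h : ExpIntegrates φ ℓ)
    (hφ : ∀ s, 0 < s → φ s = ψ s) (hm : ℓ = m) : ExpIntegrates ψ m := by
  subst hm
  obtain ⟨h1, c, hc, C, h2⟩ := h
  refine ⟨fun S hS => (h1 S hS).congr_fun (fun s hs => hφ s hs.1) measurableSet_Ioc,
    c, hc, C, fun S hS => ?_⟩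
  rw [← setIntegral_congr_fun measurableSet_Ioc (fun s (hs : s ∈ Ioc 0 S) => hφ s hs.1)]
  exact h2 S hS

theorem ExpIntegrates.const_mul {φ : ℝ → ℂ} {ℓ : ℂ} (h : ExpIntegrates φ ℓ) (k : ℂ) :
    ExpIntegrates (fun s => k * φ s) (k * ℓ) := by
  obtain ⟨h1, c, hc, C, h2⟩ := h
  refine ⟨fun S hS => (h1 S hS).const_mul k, c, hc, ‖k‖ * C, fun S hS => ?_⟩
  rw [integral_const_mul, ← mul_sub, norm_mul, mul_assoc]
  exact mul_le_mul_of_nonneg_left (h2 S hS) (norm_nonneg _)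

theorem ExpIntegrates.add {φ ψ : ℝ → ℂ} {ℓ m : ℂ} (h : ExpIntegrates φ ℓ)
    (h' : ExpIntegrates ψ m) : ExpIntegrates (fun s => φ s + ψ s) (ℓ + m) := by
  obtain ⟨h1, c, hc, C, h2⟩ := h
  obtain ⟨h1', c', hc', C', h2'⟩ := h'
  refine ⟨fun S hS => (h1 S hS).add (h1' S hS), min c c', lt_min hc hc', |C| + |C'|,
    fun S hS => ?_⟩
  rw [integral_add (h1 S hS) (h1' S hS), add_sub_add_comm, add_mul]
  refine (norm_add_le _ _).trans (add_le_add ((h2 S hS).trans ?_) ((h2' S hS).trans ?_))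
  · gcongr
    · exact le_abs_self C
    · exact min_le_left c c'
  · gcongr
    · exact le_abs_self C'
    · exact min_le_right c c'

theorem norm_mul_exp_neg_mul (k w : ℂ) (s : ℝ) :
    ‖k * Complex.exp (-s * w)‖ = ‖k‖ * Real.exp (-(s * w.re)) := by
  rw [norm_mul, Complex.norm_exp]
  simp

theorem integral_Ioc_mul_exp_neg_mul {k w : ℂ} (hw : w ≠ 0) {S : ℝ} (hS : 0 ≤ S) :
    ∫ s in Ioc 0 S, k * Complex.exp (-s * w) = k / w - k * Complex.exp (-S * w) / w := by
  rw [← intervalIntegral.integral_of_le hS, intervalIntegral.integral_const_mul]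
  have := integral_exp_mul_complex (a := 0) (b := S) (neg_ne_zero.2 hw)
  simp only [neg_mul, mul_comm w] at this ⊢
  rw [this]
  simp
  field_simp
  ring

theorem integral_Ioc_mul_exp_neg_mul_real_le (k : ℝ) (hk : 0 ≤ k) {w : ℝ} (hw : 0 < w) {S : ℝ}
    (hS : 0 ≤ S) : ∫ s in Ioc 0 S, k * Real.exp (-(s * w)) ≤ k / w := by
  have h1 : ∀ s ∈ uIcc 0 S, HasDerivAt (fun s => -(k / w) * Real.exp (-(s * w)))
      (k * Real.exp (-(s * w))) s := fun s _ => by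
    have := (((hasDerivAt_id s).mul_const w).neg.exp).const_mul (-(k / w))
    refine this.congr_deriv ?_
    simp only [id, Pi.neg_apply]
    field_simp
  rw [← intervalIntegral.integral_of_le hS, intervalIntegral.integral_eq_sub_of_hasDerivAt h1
    (Continuous.intervalIntegrable (by fun_prop) _ _)]
  have : 0 ≤ k / w * Real.exp (-(S * w)) := by positivity
  simp
  linarith

/-- From `x ≤ e^x` at `x = s Re w`, the integrand is dominated by `‖k‖ / (s Re w)`. So one
hypothesis, integrability of `‖k‖ / Re w`, serves both the exponential and its integrated form. -/
theorem integrable_mul_exp_neg_mul {μ : Measure ℝ} {k w : ℝ → ℂ} (hk : Measurable k)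
    (hw : Measurable w) (hpos : ∀ᵐ y ∂μ, 0 < (w y).re)
    (hint : Integrable (fun y => ‖k y‖ / (w y).re) μ) {s : ℝ} (hs : 0 < s) :
    Integrable (fun y => k y * Complex.exp (-s * w y)) μ := by
  refine (hint.const_mul (1 / s)).mono' (by fun_prop) ?_
  filter_upwards [hpos] with y hy
  rw [norm_mul_exp_neg_mul, Real.exp_neg]
  have h : s * (w y).re ≤ Real.exp (s * (w y).re) := by linarith [Real.add_one_le_exp (s * (w y).re)]
  calc ‖k y‖ * (Real.exp (s * (w y).re))⁻¹ ≤ ‖k y‖ * (s * (w y).re)⁻¹ := by gcongr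
    _ = _ := by field_simp

theorem integrable_div_of_norm_div_re {μ : Measure ℝ} {k w : ℝ → ℂ} (hk : Measurable k)
    (hw : Measurable w) (hpos : ∀ᵐ y ∂μ, 0 < (w y).re)
    (hint : Integrable (fun y => ‖k y‖ / (w y).re) μ) :
    Integrable (fun y => k y / w y) μ := by
  refine hint.mono' (hk.div hw).aestronglyMeasurable ?_
  filter_upwards [hpos] with y hy
  rw [norm_div]
  gcongr
  exact (le_abs_self _).trans (Complex.abs_re_le_norm _)

/-- Fubini turns the integral over `(0, S]` into that of `(k/w)(1 - e^{-Sw})`. The lower bound on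
`Re w` makes the remainder at most `e^{-cS}` times the integral of `‖k‖ / Re w`. -/
theorem expIntegrates_integral {μ : Measure ℝ} [SFinite μ] {k w : ℝ → ℂ} (hk : Measurable k)
    (hw : Measurable w) {c : ℝ} (hc : 0 < c) (hwc : ∀ᵐ y ∂μ, c ≤ (w y).re)
    (hint : Integrable (fun y => ‖k y‖ / (w y).re) μ) :
    ExpIntegrates (fun s => ∫ y, k y * Complex.exp (-s * w y) ∂μ) (∫ y, k y / w y ∂μ) := by
  have hpos : ∀ᵐ y ∂μ, 0 < (w y).re := hwc.mono fun y hy => hc.trans_le hy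
  have hdiv := integrable_div_of_norm_div_re hk hw hpos hint
  have hprod : ∀ S, 0 < S → Integrable (fun p : ℝ × ℝ => k p.2 * Complex.exp (-p.1 * w p.2))
      ((volume.restrict (Ioc 0 S)).prod μ) := fun S hS => by
    have hm : Measurable (fun p : ℝ × ℝ => k p.2 * Complex.exp (-p.1 * w p.2)) := by fun_prop
    refine (integrable_prod_iff' hm.aestronglyMeasurable).2 ⟨ae_of_all _ fun y => ?_, ?_⟩
    · have : Continuous fun s : ℝ => k y * Complex.exp (-s * w y) := by fun_prop
      exact this.integrableOn_Icc.mono_set Ioc_subset_Icc_self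
    · refine hint.mono' (hm.norm.aestronglyMeasurable.prod_swap.integral_prod_right') ?_
      filter_upwards [hpos] with y hy
      rw [Real.norm_of_nonneg (integral_nonneg fun _ => norm_nonneg _)]
      simp only [norm_mul_exp_neg_mul]
      exact integral_Ioc_mul_exp_neg_mul_real_le _ (norm_nonneg _) hy hS.le
  refine ⟨fun S hS => (hprod S hS).integral_prod_left, c, hc, ∫ y, ‖k y‖ / (w y).re ∂μ,
    fun S hS => ?_⟩
  have htail : ∀ᵐ y ∂μ, ‖k y * Complex.exp (-S * w y) / w y‖
      ≤ ‖k y‖ / (w y).re * Real.exp (-c * S) := by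
    filter_upwards [hwc] with y hy
    have hy' : 0 < (w y).re := hc.trans_le hy
    rw [norm_div, norm_mul_exp_neg_mul, mul_div_right_comm]
    gcongr
    · exact (le_abs_self _).trans (Complex.abs_re_le_norm _)
    · nlinarith
  have htint : Integrable (fun y => k y * Complex.exp (-S * w y) / w y) μ :=
    (hint.mul_const _).mono' (Measurable.div (by fun_prop) hw).aestronglyMeasurable htail
  rw [integral_integral_swap (hprod S hS)]
  have : ∫ y, (∫ s in Ioc 0 S, k y * Complex.exp (-s * w y)) ∂μ
      = ∫ y, (k y / w y - k y * Complex.exp (-S * w y) / w y) ∂μ := by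
    refine integral_congr_ae ?_
    filter_upwards [hpos] with y hy
    exact integral_Ioc_mul_exp_neg_mul (fun h => by simp [h] at hy) hS.le
  rw [this, integral_sub hdiv htint, sub_sub_cancel_left, norm_neg, ← integral_mul_const]
  exact norm_integral_le_of_norm_le (hint.mul_const _) htail

/-! ### Second-order expansion of the sine with entire remainders -/

/-- Divided differences at `0` of an entire function are entire; evenness of `σ` kills its linear
term. These functions let the Laurent coefficients of the integrands be read off by algebra. -/
theorem exists_sin_expansion : ∃ σ τ : ℂ → ℂ, Differentiable ℂ σ ∧ Differentiable ℂ τ ∧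
    (∀ z, Complex.sin z = z * σ z) ∧ (∀ z, σ z = 1 - z ^ 2 * τ z) ∧ τ 0 = 1 / 6 := by
  have hd : ∀ f : ℂ → ℂ, Differentiable ℂ f → Differentiable ℂ (dslope f 0) := fun f hf => by
    rw [← differentiableOn_univ] at hf ⊢
    exact (Complex.differentiableOn_dslope univ_mem).2 hf
  have hs : ∀ (f : ℂ → ℂ) (z : ℂ), f z = f 0 + z * dslope f 0 z := fun f z => by
    have := sub_smul_dslope f 0 z
    simp only [sub_zero, smul_eq_mul] at this
    rw [this]; ring
  set σ := dslope Complex.sin 0 with hσ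
  have dσ : Differentiable ℂ σ := hd _ Complex.differentiable_sin
  have h1 : ∀ z, Complex.sin z = z * σ z := fun z => by simpa using hs Complex.sin z
  have hσ0 : σ 0 = 1 := by simp [hσ, dslope_same]
  have heven : ∀ z, σ (-z) = σ z := fun z => by
    rcases eq_or_ne z 0 with rfl | hz
    · simp
    · have h := h1 (-z)
      rw [Complex.sin_neg, h1 z] at h
      exact mul_left_cancel₀ hz (by linear_combination h)
  have hder : deriv σ 0 = 0 := by
    have h := deriv_comp_neg (f := σ) (0 : ℂ)
    simp only [heven, neg_zero] at h
    exact CharZero.eq_neg_self_iff.1 h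
  set σ' := dslope σ 0 with hσ'
  have h2 : ∀ z, σ z = 1 + z * σ' z := fun z => by simpa [hσ0] using hs σ z
  have h0 : σ' 0 = 0 := by rw [hσ', dslope_same, hder]
  have h3 : ∀ z, σ' z = z * dslope σ' 0 z := fun z => by simpa [h0] using hs σ' z
  have dτ : Differentiable ℂ (fun z => -dslope σ' 0 z) := (hd _ (hd _ dσ)).neg
  refine ⟨σ, fun z => -dslope σ' 0 z, dσ, dτ, h1, fun z => by rw [h2, h3]; ring, ?_⟩
  have h4 : ∀ z, σ z = 1 - z ^ 2 * (-dslope σ' 0 z) := fun z => by rw [h2, h3]; ring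
  -- The triple-angle formula divided by `z³` gives `27 τ(3z) = 3 τ(z) + 4 σ(z)³` off the origin,
  -- hence everywhere by continuity. At `0` it reads `24 τ(0) = 4`.
  have h5 : (fun z : ℂ => 27 * -dslope σ' 0 (3 * z)) =
      fun z => 3 * -dslope σ' 0 z + 4 * σ z ^ 3 := by
    refine Continuous.ext_on (dense_compl_singleton (0 : ℂ)) ?_ ?_ fun z hz => ?_
    · exact continuous_const.mul (dτ.continuous.comp (by fun_prop))
    · exact (continuous_const.mul dτ.continuous).add (continuous_const.mul (dσ.continuous.pow 3))
    · have h := Complex.sin_three_mul z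
      rw [h1, h1, h4 (3 * z)] at h
      refine mul_left_cancel₀ (pow_ne_zero 3 hz) ?_
      linear_combination -h - 3 * z * h4 z
  have h6 := congrFun h5 0
  simp only [mul_zero, hσ0] at h6
  linear_combination h6 / 24


/-! ### Half residues along the corner path -/

/-- The integral of `F` from `δ - iη` up to `δ + iη` and then left to `-δ + iη`. -/
noncomputable def cornerIntegral (δ η : ℝ) (F : ℂ → ℂ) : ℂ :=
  Complex.I * (∫ y in -η..η, F (δ + y * Complex.I)) - ∫ x in -δ..δ, F (x + η * Complex.I)

theorem cornerIntegral_of_hasDerivAt {δ η : ℝ} (hδ : 0 < δ) (hη : 0 < η) {Q F : ℂ → ℂ}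
    (hQ : ∀ z ∈ Complex.slitPlane, HasDerivAt Q (F z) z) (hF : ContinuousOn F Complex.slitPlane) :
    cornerIntegral δ η F = Q (-(δ - η * Complex.I)) - Q (δ - η * Complex.I) := by
  have hv : ∀ y : ℝ, (δ + y * Complex.I : ℂ) ∈ Complex.slitPlane := fun y => Or.inl (by simpa)
  have hh : ∀ x : ℝ, (x + η * Complex.I : ℂ) ∈ Complex.slitPlane :=
    fun x => Or.inr (by simpa using hη.ne')
  have cv : Continuous fun y : ℝ => F (δ + y * Complex.I) :=
    hF.comp_continuous (by fun_prop) hv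
  have ch : Continuous fun x : ℝ => F (x + η * Complex.I) :=
    hF.comp_continuous (by fun_prop) hh
  have e1 : ∫ y in -η..η, Complex.I * F (δ + y * Complex.I)
      = Q (δ + η * Complex.I) - Q (δ - η * Complex.I) := by
    rw [intervalIntegral.integral_eq_sub_of_hasDerivAt
      (f := fun y : ℝ => Q (δ + y * Complex.I)) _ ((cv.const_mul _).intervalIntegrable _ _)]
    · simp [sub_eq_add_neg]
    · intro y _
      have h : HasDerivAt (fun y : ℂ => (δ : ℂ) + y * Complex.I) Complex.I y := by
        simpa using ((hasDerivAt_id (y : ℂ)).mul_const Complex.I).const_add (δ : ℂ)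
      have := ((hQ _ (hv y)).comp (y : ℂ) h).comp_ofReal
      rwa [mul_comm] at this
  have e2 : ∫ x in -δ..δ, F (x + η * Complex.I)
      = Q (δ + η * Complex.I) - Q (-(δ - η * Complex.I)) := by
    rw [intervalIntegral.integral_eq_sub_of_hasDerivAt
      (f := fun x : ℝ => Q (x + η * Complex.I)) _ (ch.intervalIntegrable _ _)]
    · congr 2
      push_cast
      ring
    · intro x _
      have h : HasDerivAt (fun x : ℂ => x + η * Complex.I) 1 x :=
        (hasDerivAt_id (x : ℂ)).add_const _
      have := ((hQ _ (hh x)).comp (x : ℂ) h).comp_ofReal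
      rwa [mul_one] at this
  rw [cornerIntegral, ← intervalIntegral.integral_const_mul, e1, e2]
  ring

theorem log_neg_of_im_neg {w : ℂ} (hw : w.im < 0) :
    Complex.log (-w) = Complex.log w + Real.pi * Complex.I := by
  rw [Complex.log, Complex.log, Complex.arg_neg_eq_arg_add_pi_of_im_neg hw, norm_neg]
  push_cast
  ring

/-- The path stays in the slit plane and joins `w` to `-w`. The primitive of the cubic term is even
and contributes nothing; the logarithm gains half a turn, `πi`. -/
theorem cornerIntegral_pole {δ η : ℝ} (hδ : 0 < δ) (hη : 0 < η) (b c : ℂ) :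
    cornerIntegral δ η (fun z => b / z ^ 3 + c / z) = c * (Real.pi * Complex.I) := by
  have hne : ∀ z ∈ Complex.slitPlane, z ≠ 0 := fun z => Complex.slitPlane_ne_zero
  rw [cornerIntegral_of_hasDerivAt (Q := fun z => -b / 2 / z ^ 2 + c * Complex.log z) hδ hη]
  · have hw : (δ - η * Complex.I : ℂ).im < 0 := by simpa
    simp only [log_neg_of_im_neg hw, neg_sq]
    ring
  · intro z hz
    have h0 := hne z hz
    have h1 := ((hasDerivAt_const z (-b / 2)).div (hasDerivAt_pow 2 z) (pow_ne_zero 2 h0)).add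
      ((Complex.hasDerivAt_log hz).const_mul c)
    refine h1.congr_deriv ?_
    field_simp
    simp
    ring
  · refine ContinuousOn.add ?_ ?_
    · exact continuousOn_const.div (by fun_prop) fun z hz => pow_ne_zero 3 (hne z hz)
    · exact continuousOn_const.div (by fun_prop) hne

theorem right_edge_mem {δ η y : ℝ} (hδ : 0 < δ) (hy : y ∈ Icc (-η) η) :
    (δ + y * Complex.I : ℂ) ∈ (Icc (-δ) δ ×ℂ Icc (-η) η) \ {0} :=
  ⟨⟨by simp [hδ.le], by simpa using hy⟩, fun h => hδ.ne' (by simpa using congrArg Complex.re h)⟩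

theorem top_edge_mem {δ η x : ℝ} (hη : 0 < η) (hx : x ∈ Icc (-δ) δ) :
    (x + η * Complex.I : ℂ) ∈ (Icc (-δ) δ ×ℂ Icc (-η) η) \ {0} :=
  ⟨⟨by simpa using hx, by simp [hη.le]⟩, fun h => hη.ne' (by simpa using congrArg Complex.im h)⟩

theorem cornerIntegral_congr {δ η : ℝ} (hδ : 0 < δ) (hη : 0 < η) {F G : ℂ → ℂ}
    (h : EqOn F G ((Icc (-δ) δ ×ℂ Icc (-η) η) \ {0})) :
    cornerIntegral δ η F = cornerIntegral δ η G := by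
  rw [cornerIntegral, cornerIntegral]
  congr 1
  · congr 1
    refine intervalIntegral.integral_congr fun y hy => h (right_edge_mem hδ ?_)
    rwa [uIcc_of_le (by linarith)] at hy
  · refine intervalIntegral.integral_congr fun x hx => h (top_edge_mem hη ?_)
    rwa [uIcc_of_le (by linarith)] at hx

theorem cornerIntegral_add {δ η : ℝ} (hδ : 0 < δ) (hη : 0 < η) {F G : ℂ → ℂ}
    (hF : ContinuousOn F ((Icc (-δ) δ ×ℂ Icc (-η) η) \ {0}))
    (hG : ContinuousOn G ((Icc (-δ) δ ×ℂ Icc (-η) η) \ {0})) :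
    cornerIntegral δ η (fun z => F z + G z) = cornerIntegral δ η F + cornerIntegral δ η G := by
  have h1 : ∀ F : ℂ → ℂ, ContinuousOn F ((Icc (-δ) δ ×ℂ Icc (-η) η) \ {0}) →
      IntervalIntegrable (fun y : ℝ => F (δ + y * Complex.I)) volume (-η) η ∧
      IntervalIntegrable (fun x : ℝ => F (x + η * Complex.I)) volume (-δ) δ := fun F hF =>
    ⟨ContinuousOn.intervalIntegrable_of_Icc (by linarith)
      (hF.comp (by fun_prop) fun y hy => right_edge_mem hδ hy),
    ContinuousOn.intervalIntegrable_of_Icc (by linarith)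
      (hF.comp (by fun_prop) fun y hy => top_edge_mem hη hy)⟩
  simp only [cornerIntegral]
  rw [intervalIntegral.integral_add (h1 F hF).1 (h1 G hG).1,
    intervalIntegral.integral_add (h1 F hF).2 (h1 G hG).2]
  ring

/-- The other two sides of the rectangle are the image of the corner path under `z ↦ -z`, so for odd
`F` the boundary integral, zero by Cauchy, is twice the corner integral. -/
theorem cornerIntegral_eq_zero_of_odd {δ η : ℝ} (hδ : 0 < δ) (hη : 0 < η) {F : ℂ → ℂ}
    (hF : DifferentiableOn ℂ F (Icc (-δ) δ ×ℂ Icc (-η) η))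
    (hodd : ∀ z ∈ (Icc (-δ) δ ×ℂ Icc (-η) η) \ {0}, F (-z) = -F z) :
    cornerIntegral δ η F = 0 := by
  have hδ' : -δ ≤ δ := by linarith
  have hη' : -η ≤ η := by linarith
  have h := Complex.integral_boundary_rect_eq_zero_of_differentiableOn F ⟨-δ, -η⟩ ⟨δ, η⟩
    (by simpa only [uIcc_of_le hδ', uIcc_of_le hη'])
  have e1 : ∫ x in -δ..δ, F (x + ((-η : ℝ) : ℂ) * Complex.I)
      = -∫ x in -δ..δ, F (x + η * Complex.I) := by
    have := intervalIntegral.integral_comp_neg (a := -δ) (b := δ)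
      (fun x : ℝ => -F (x + η * Complex.I))
    rw [neg_neg] at this
    rw [← intervalIntegral.integral_neg, ← this]
    refine intervalIntegral.integral_congr fun x hx => ?_
    rw [uIcc_of_le hδ'] at hx
    rw [← hodd _ (top_edge_mem hη ⟨by linarith [hx.2], by linarith [hx.1]⟩)]
    congr 1
    push_cast
    ring
  have e2 : ∫ y in -η..η, F (((-δ : ℝ) : ℂ) + y * Complex.I)
      = -∫ y in -η..η, F (δ + y * Complex.I) := by
    have := intervalIntegral.integral_comp_neg (a := -η) (b := η)
      (fun y : ℝ => -F (δ + y * Complex.I))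
    rw [neg_neg] at this
    rw [← intervalIntegral.integral_neg, ← this]
    refine intervalIntegral.integral_congr fun x hx => ?_
    rw [uIcc_of_le hη'] at hx
    rw [← hodd _ (right_edge_mem hδ ⟨by linarith [hx.2], by linarith [hx.1]⟩)]
    congr 1
    push_cast
    ring
  simp only [smul_eq_mul] at h
  rw [e1, e2] at h
  rw [cornerIntegral]
  linear_combination h / 2

/-- Subtracting the odd principal part `b/z³ + G(0)/z` leaves `dslope G 0`, which is holomorphic on
the rectangle and odd off the origin, so only the pole contributes. -/
theorem cornerIntegral_of_odd {δ η : ℝ} (hδ : 0 < δ) (hη : 0 < η) {F G : ℂ → ℂ} {b : ℂ}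
    (hG : DifferentiableOn ℂ G (Icc (-δ) δ ×ℂ Icc (-η) η)) (hodd : ∀ z, F (-z) = -F z)
    (hFG : ∀ z ∈ (Icc (-δ) δ ×ℂ Icc (-η) η) \ {0}, F z = b / z ^ 3 + G z / z) :
    cornerIntegral δ η F = G 0 * (Real.pi * Complex.I) := by
  have hK : Icc (-δ) δ ×ℂ Icc (-η) η ∈ 𝓝 (0 : ℂ) := by
    refine mem_of_superset ((isOpen_Ioo.reProdIm isOpen_Ioo).mem_nhds
      (show (0 : ℂ) ∈ Ioo (-δ) δ ×ℂ Ioo (-η) η from ?_))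
      (inter_subset_inter (preimage_mono Ioo_subset_Icc_self) (preimage_mono Ioo_subset_Icc_self))
    exact ⟨by simp [hδ], by simp [hη]⟩
  set p : ℂ → ℂ := fun z => b / z ^ 3 + G 0 / z with hp
  have hpodd : ∀ z, p (-z) = -p z := fun z => by
    simp only [hp]
    rw [Odd.neg_pow (by decide), div_neg, div_neg]
    ring
  have hd : DifferentiableOn ℂ (dslope G 0) (Icc (-δ) δ ×ℂ Icc (-η) η) :=
    (Complex.differentiableOn_dslope hK).2 hG
  have hsl : ∀ z ∈ (Icc (-δ) δ ×ℂ Icc (-η) η) \ {0}, dslope G 0 z = F z - p z := by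
    intro z hz
    rw [hFG z hz, dslope_of_ne _ hz.2, slope_def_field, hp]
    simp only [sub_zero]
    ring
  have hneg : ∀ z ∈ (Icc (-δ) δ ×ℂ Icc (-η) η) \ {0},
      -z ∈ (Icc (-δ) δ ×ℂ Icc (-η) η) \ {0} := by
    rintro z ⟨⟨h1, h2⟩, h3⟩
    refine ⟨⟨?_, ?_⟩, fun h => h3 (neg_eq_zero.1 h)⟩
    · rw [mem_preimage, Complex.neg_re]; exact ⟨neg_le_neg h1.2, by linarith [h1.1]⟩
    · rw [mem_preimage, Complex.neg_im]; exact ⟨neg_le_neg h2.2, by linarith [h2.1]⟩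
  have hcp : ContinuousOn p ((Icc (-δ) δ ×ℂ Icc (-η) η) \ {0}) :=
    (continuousOn_const.div (by fun_prop) fun z hz => pow_ne_zero 3 hz.2).add
      (continuousOn_const.div (by fun_prop) fun z hz => hz.2)
  rw [cornerIntegral_congr hδ hη (G := fun z => p z + dslope G 0 z)
    (fun z hz => by dsimp only; rw [hsl z hz]; ring),
    cornerIntegral_add hδ hη hcp (hd.continuousOn.mono sdiff_subset), cornerIntegral_pole hδ hη,
    cornerIntegral_eq_zero_of_odd hδ hη hd, add_zero]
  intro z hz
  rw [hsl z hz, hsl _ (hneg z hz), hodd, hpodd]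
  ring

/-! ### Deforming the upper contour -/

/-- The integral of `F` from `π + i∞` down to `π + iη`, left to `-π + iη` and up to `-π + i∞`. -/
noncomputable def upperContour (η : ℝ) (F : ℂ → ℂ) : ℂ :=
  Complex.I * (∫ y in Ioi η,
      (F (-Real.pi + y * Complex.I) - F (Real.pi + y * Complex.I)))
    - ∫ x in -Real.pi..Real.pi, F (x + η * Complex.I)

theorem contourIntegralA_zero_of_odd {F : ℂ → ℂ} (hodd : ∀ z, F (-z) = -F z) :
    contourIntegralA 0 F = 2 * upperContour 1 F := by
  have e1 : ∫ y in Iio (-1 : ℝ), (F (-Real.pi + y * Complex.I) - F (Real.pi + y * Complex.I))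
      = ∫ y in Ioi (1 : ℝ), (F (-Real.pi + y * Complex.I) - F (Real.pi + y * Complex.I)) := by
    rw [← integral_Iic_eq_integral_Iio, ← integral_comp_neg_Ioi]
    refine integral_congr_ae (ae_of_all _ fun y => ?_)
    have h1 := hodd (-Real.pi + y * Complex.I)
    have h2 := hodd (Real.pi + y * Complex.I)
    rw [show -(-Real.pi + y * Complex.I : ℂ) = Real.pi + (-y : ℝ) * Complex.I by push_cast; ring]
      at h1
    rw [show -(Real.pi + y * Complex.I : ℂ) = -Real.pi + (-y : ℝ) * Complex.I by push_cast; ring]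
      at h2
    dsimp only
    rw [h1, h2]
    ring
  have e2 : ∫ x in -Real.pi..Real.pi, F (x - Complex.I)
      = -∫ x in -Real.pi..Real.pi, F (x + Complex.I) := by
    have := intervalIntegral.integral_comp_neg (a := -Real.pi) (b := Real.pi)
      (fun x : ℝ => -F (x + Complex.I))
    rw [neg_neg] at this
    rw [← intervalIntegral.integral_neg, ← this]
    refine intervalIntegral.integral_congr fun x _ => ?_
    rw [← hodd]
    congr 1
    push_cast
    ring
  simp only [contourIntegralA, upperContour, zero_sub, zero_add, Complex.ofReal_neg, e1, e2,
    Complex.ofReal_one, one_mul]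
  ring

theorem upperContour_rectangle {F : ℂ → ℂ} (hF : ∀ z : ℂ, 0 < z.im → DifferentiableAt ℂ F z)
    {η Y : ℝ} (hη : 0 < η) (hY : η ≤ Y) :
    Complex.I * (∫ y in η..Y, (F (-Real.pi + y * Complex.I) - F (Real.pi + y * Complex.I)))
      - (∫ x in -Real.pi..Real.pi, F (x + η * Complex.I))
      + ∫ x in -Real.pi..Real.pi, F (x + Y * Complex.I) = 0 := by
  have h := Complex.integral_boundary_rect_eq_zero_of_differentiableOn F ⟨-Real.pi, η⟩ ⟨Real.pi, Y⟩
    fun z hz => (hF z (by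
      have := hz.2
      simp only [mem_preimage, uIcc_of_le hY] at this
      exact hη.trans_le this.1)).differentiableWithinAt
  have hi : ∀ c : ℂ, c.im = 0 →
      IntervalIntegrable (fun y : ℝ => F (c + y * Complex.I)) volume η Y := fun c hc => by
    refine ContinuousOn.intervalIntegrable_of_Icc hY fun y hy => ?_
    have := (hF (c + y * Complex.I) (by simpa [hc] using hη.trans_le hy.1)).continuousAt
    exact (this.comp (f := fun y : ℝ => c + y * Complex.I) (by fun_prop)).continuousWithinAt
  rw [intervalIntegral.integral_sub (hi _ (by simp)) (hi _ (by simp))]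
  simp only [smul_eq_mul, Complex.ofReal_neg] at h
  linear_combination -h

theorem upperContour_eq {F : ℂ → ℂ} (hF : ∀ z : ℂ, 0 < z.im → DifferentiableAt ℂ F z)
    {η Y : ℝ} (hη : 0 < η) (hY : η ≤ Y)
    (hl : IntegrableOn (fun y : ℝ => F (-Real.pi + y * Complex.I)) (Ioi η))
    (hr : IntegrableOn (fun y : ℝ => F (Real.pi + y * Complex.I)) (Ioi η)) :
    upperContour Y F = upperContour η F := by
  have h := upperContour_rectangle hF hη hY
  have hi := intervalIntegral.integral_interval_add_Ioi (hl.sub hr)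
    ((hl.sub hr).mono_set (Ioi_subset_Ioi hY))
  simp only [Pi.sub_apply] at hi
  rw [upperContour, upperContour, ← hi]
  linear_combination -h

/-- Close the contour by a horizontal segment at height `Y`, apply Cauchy to the rectangle and let
`Y → ∞`. -/
theorem upperContour_eq_zero {F : ℂ → ℂ} (hF : ∀ z : ℂ, 0 < z.im → DifferentiableAt ℂ F z)
    {η : ℝ} (hη : 0 < η)
    (hl : IntegrableOn (fun y : ℝ => F (-Real.pi + y * Complex.I)) (Ioi η))
    (hr : IntegrableOn (fun y : ℝ => F (Real.pi + y * Complex.I)) (Ioi η))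
    (htop : Tendsto (fun Y : ℝ => ∫ x in -Real.pi..Real.pi, F (x + Y * Complex.I)) atTop (𝓝 0)) :
    upperContour η F = 0 := by
  have h := ((((intervalIntegral_tendsto_integral_Ioi η (hl.sub hr) tendsto_id).const_mul
    Complex.I).sub_const (∫ x in -Real.pi..Real.pi, F (x + η * Complex.I))).add htop)
  simp only [Pi.sub_apply, add_zero, id] at h
  refine tendsto_nhds_unique h (tendsto_const_nhds.congr' ?_)
  filter_upwards [eventually_ge_atTop η] with Y hY
  exact (upperContour_rectangle hF hη hY).symm

/-- The part of the upper contour away from the origin: the two vertical rays, the two horizontal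
segments outside `|Re z| < δ`, and the segment from `δ + iη` down to `δ - iη`. -/
noncomputable def outerContour (δ η : ℝ) (F : ℂ → ℂ) : ℂ :=
  Complex.I * (∫ y in Ioi η, F (-Real.pi + y * Complex.I))
    + -Complex.I * (∫ y in Ioi η, F (Real.pi + y * Complex.I))
    + -1 * (∫ x in Ioc (-Real.pi) (-δ), F (x + η * Complex.I))
    + -1 * (∫ x in Ioc δ Real.pi, F (x + η * Complex.I))
    + -Complex.I * (∫ y in Ioc (-η) η, F (δ + y * Complex.I))

theorem upperContour_eq_outerContour_add {F : ℂ → ℂ}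
    (hF : ∀ z : ℂ, 0 < z.im → DifferentiableAt ℂ F z)
    {δ η : ℝ} (hη : 0 < η) (hδ : δ ≤ Real.pi)
    (hl : IntegrableOn (fun y : ℝ => F (-Real.pi + y * Complex.I)) (Ioi η))
    (hr : IntegrableOn (fun y : ℝ => F (Real.pi + y * Complex.I)) (Ioi η)) :
    upperContour η F = outerContour δ η F + cornerIntegral δ η F := by
  have hc : Continuous fun x : ℝ => F (x + η * Complex.I) := by
    refine continuous_iff_continuousAt.2 fun x => ?_
    have := (hF (x + η * Complex.I) (by simpa using hη)).continuousAt
    exact this.comp (f := fun x : ℝ => (x + η * Complex.I : ℂ)) (by fun_prop)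
  rw [upperContour, outerContour, cornerIntegral, integral_sub hl hr,
    ← intervalIntegral.integral_of_le (by linarith), ← intervalIntegral.integral_of_le hδ,
    ← intervalIntegral.integral_of_le (by linarith),
    ← intervalIntegral.integral_add_adjacent_intervals (a := -Real.pi) (b := -δ) (c := Real.pi)
      (hc.intervalIntegrable _ _) (hc.intervalIntegrable _ _),
    ← intervalIntegral.integral_add_adjacent_intervals (a := -δ) (b := δ) (c := Real.pi)
      (hc.intervalIntegrable _ _) (hc.intervalIntegrable _ _)]
  ring

/-! ### The heat integrand and its integral in `s`: bounds and residues -/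

/-- The integrand of Carslaw's formula on the diagonal. -/
noncomputable def coneIntegrand (a s : ℝ) (z : ℂ) : ℂ :=
  Complex.cot (a * z) * Complex.exp (-s * (1 - Complex.cos z))

/-- The integral of `coneIntegrand a s` over `s ∈ (0, ∞)`. -/
noncomputable def coneWeight (a : ℝ) (z : ℂ) : ℂ :=
  Complex.cot (a * z) / (1 - Complex.cos z)

theorem cot_neg_complex (z : ℂ) : Complex.cot (-z) = -Complex.cot z := by
  rw [Complex.cot, Complex.cot, Complex.cos_neg, Complex.sin_neg, div_neg]

theorem coneIntegrand_neg (a s : ℝ) (z : ℂ) : coneIntegrand a s (-z) = -coneIntegrand a s z := by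
  rw [coneIntegrand, coneIntegrand, mul_neg, cot_neg_complex, Complex.cos_neg, neg_mul]

theorem coneWeight_neg (a : ℝ) (z : ℂ) : coneWeight a (-z) = -coneWeight a z := by
  rw [coneWeight, coneWeight, mul_neg, cot_neg_complex, Complex.cos_neg, neg_div]

theorem sin_ne_zero_of_im_ne_zero {z : ℂ} (hz : z.im ≠ 0) : Complex.sin z ≠ 0 := by
  intro h
  obtain ⟨k, rfl⟩ := Complex.sin_eq_zero_iff.1 h
  simp at hz

theorem sin_ne_zero_of_abs_re_lt_pi {z : ℂ} (hz : z ≠ 0) (h : |z.re| < Real.pi) :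
    Complex.sin z ≠ 0 := by
  intro h0
  obtain ⟨k, rfl⟩ := Complex.sin_eq_zero_iff.1 h0
  have h1 : |(k : ℝ)| * Real.pi < 1 * Real.pi := by
    simpa [abs_mul, abs_of_pos Real.pi_pos] using h
  have h2 : |(k : ℝ)| < 1 := lt_of_mul_lt_mul_right h1 Real.pi_pos.le
  have h3 : k = 0 := by
    rw [← Int.abs_lt_one_iff]
    exact_mod_cast h2
  simp [h3] at hz

theorem one_sub_cos_eq (z : ℂ) : 1 - Complex.cos z = 2 * Complex.sin (z / 2) ^ 2 := by
  have h := Complex.cos_two_mul (z / 2)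
  have h' := Complex.sin_sq_add_cos_sq (z / 2)
  rw [mul_div_cancel₀ z two_ne_zero] at h
  linear_combination -h - 2 * h'

theorem im_real_mul_ne_zero {a : ℝ} (ha : 0 < a) {z : ℂ} (hz : 0 < z.im) : (a * z).im ≠ 0 := by
  rw [Complex.im_ofReal_mul]
  positivity

theorem differentiableAt_cot_real_mul {a : ℝ} {z : ℂ} (hz : Complex.sin (a * z) ≠ 0) :
    DifferentiableAt ℂ (fun z => Complex.cot (a * z)) z := by
  simp only [Complex.cot]
  exact DifferentiableAt.div (by fun_prop) (by fun_prop) hz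

theorem differentiableAt_coneIntegrand {a : ℝ} (ha : 0 < a) (s : ℝ) {z : ℂ} (hz : 0 < z.im) :
    DifferentiableAt ℂ (coneIntegrand a s) z :=
  (differentiableAt_cot_real_mul (sin_ne_zero_of_im_ne_zero (im_real_mul_ne_zero ha hz))).mul
    (by fun_prop)

theorem differentiableAt_coneWeight {a : ℝ} (ha : 0 < a) {z : ℂ} (hz : 0 < z.im) :
    DifferentiableAt ℂ (coneWeight a) z := by
  refine (differentiableAt_cot_real_mul (sin_ne_zero_of_im_ne_zero
    (im_real_mul_ne_zero ha hz))).div (by fun_prop) ?_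
  rw [one_sub_cos_eq]
  refine mul_ne_zero two_ne_zero (pow_ne_zero 2 (sin_ne_zero_of_im_ne_zero ?_))
  simpa using hz.ne'

theorem measurable_cot : Measurable Complex.cot :=
  Complex.measurable_cos.div Complex.measurable_sin

theorem sinh_im_le_norm_sin (z : ℂ) : Real.sinh z.im ≤ ‖Complex.sin z‖ := by
  have h := norm_sub_norm_le (Complex.exp (-z * Complex.I)) (Complex.exp (z * Complex.I))
  simp only [Complex.norm_exp] at h
  rw [Real.sinh_eq, Complex.sin, norm_div, norm_mul, Complex.norm_I, mul_one,
    show ‖(2 : ℂ)‖ = 2 by simp]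
  gcongr
  simpa using h

theorem norm_cos_le_cosh_im (z : ℂ) : ‖Complex.cos z‖ ≤ Real.cosh z.im := by
  have h := norm_add_le (Complex.exp (z * Complex.I)) (Complex.exp (-z * Complex.I))
  simp only [Complex.norm_exp] at h
  rw [Real.cosh_eq, Complex.cos, norm_div, show ‖(2 : ℂ)‖ = 2 by simp]
  gcongr
  rw [add_comm (Real.exp _)]
  simpa using h

/-- With `y = Im z`, the quotient is at most `coth y = 1 + e^{-y} / sinh y`, and `sinh y ≥ y`. -/
theorem norm_cot_le {z : ℂ} (hz : 0 < z.im) : ‖Complex.cot z‖ ≤ 1 + 1 / z.im := by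
  have hs : 0 < Real.sinh z.im := Real.sinh_pos_iff.2 hz
  rw [Complex.cot, norm_div]
  calc ‖Complex.cos z‖ / ‖Complex.sin z‖ ≤ Real.cosh z.im / Real.sinh z.im :=
        div_le_div₀ (Real.cosh_pos _).le (norm_cos_le_cosh_im z) hs (sinh_im_le_norm_sin z)
    _ ≤ 1 + 1 / z.im := by
      have h1 := Real.cosh_sub_sinh z.im
      have h2 : Real.exp (-z.im) ≤ 1 := Real.exp_le_one_iff.2 (by linarith)
      have h3 : z.im ≤ Real.sinh z.im := Real.self_le_sinh_iff.2 hz.le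
      have h4 : 1 ≤ Real.sinh z.im / z.im := (one_le_div hz).2 h3
      rw [div_le_iff₀ hs, add_mul, one_mul, one_div_mul_eq_div]
      linarith

theorem one_sub_cos_re (x y : ℝ) :
    (1 - Complex.cos (x + y * Complex.I)).re = 1 - Real.cos x * Real.cosh y := by
  rw [Complex.cos_add_mul_I, ← Complex.ofReal_cos, ← Complex.ofReal_cosh, ← Complex.ofReal_sin,
    ← Complex.ofReal_sinh]
  simp [-Complex.ofReal_cos, -Complex.ofReal_cosh, -Complex.ofReal_sin, -Complex.ofReal_sinh]

theorem two_mul_sinh_sq_le_norm_one_sub_cos {z : ℂ} (hz : 0 ≤ z.im) :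
    2 * Real.sinh (z.im / 2) ^ 2 ≤ ‖1 - Complex.cos z‖ := by
  rw [one_sub_cos_eq, norm_mul, norm_pow]
  have h : (z / 2).im = z.im / 2 := by simp
  have h2 := sinh_im_le_norm_sin (z / 2)
  rw [h] at h2
  have : 0 ≤ Real.sinh (z.im / 2) := Real.sinh_nonneg_iff.2 (by linarith)
  rw [show ‖(2 : ℂ)‖ = 2 by simp]
  gcongr

/-- On such a vertical ray the denominator is `1 + cosh y ≥ e^y / 2`, while the cotangent stays
bounded. -/
theorem integrable_ray {a c η : ℝ} (ha : 0 < a) (hη : 0 < η) (hc : Real.cos c = -1) :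
    Integrable (fun y : ℝ => ‖Complex.cot (a * (c + y * Complex.I))‖
      / (1 - Complex.cos (c + y * Complex.I)).re) (volume.restrict (Ioi η)) := by
  refine ((integrableOn_exp_neg_Ioi η).const_mul ((1 + 1 / (a * η)) * 2)).mono'
    (Measurable.aestronglyMeasurable ?_) ?_
  · exact ((measurable_cot.comp (by fun_prop)).norm).div (by fun_prop)
  · refine (ae_restrict_mem measurableSet_Ioi).mono fun y hy => ?_
    have hy' : η < y := hy
    have hy0 : 0 < y := hη.trans hy'
    have him : (a * (c + y * Complex.I) : ℂ).im = a * y := by simp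
    have h1 := norm_cot_le (z := a * (c + y * Complex.I)) (by rw [him]; positivity)
    rw [him] at h1
    have h2 : 1 / (a * y) ≤ 1 / (a * η) := by gcongr
    have h3 := Real.cosh_pos y
    have h4 : Real.exp y / 2 ≤ 1 + Real.cosh y := by
      rw [Real.cosh_eq]
      linarith [Real.exp_pos (-y)]
    rw [one_sub_cos_re, hc, neg_one_mul, sub_neg_eq_add, Real.norm_of_nonneg (by positivity)]
    calc _ ≤ (1 + 1 / (a * η)) / (Real.exp y / 2) := by
          gcongr
          linarith
      _ = _ := by
          rw [Real.exp_neg]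
          field_simp

theorem ne_zero_of_sin_eq_mul {σ : ℂ → ℂ} (h0 : σ 0 = 1) (hσ : ∀ z, Complex.sin z = z * σ z)
    {b δ : ℝ} (hb : 0 < b) (hbδ : b * δ < Real.pi) {z : ℂ} (hz : z.re ∈ Icc (-δ) δ) :
    σ (b * z) ≠ 0 := by
  rcases eq_or_ne (b * z : ℂ) 0 with h | h
  · simp [h, h0]
  · have h1 : |(b * z : ℂ).re| < Real.pi := by
      rw [Complex.re_ofReal_mul, abs_mul, abs_of_pos hb]
      exact (mul_le_mul_of_nonneg_left (abs_le.2 hz) hb.le).trans_lt hbδ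
    have h2 := sin_ne_zero_of_abs_re_lt_pi h h1
    rw [hσ] at h2
    exact right_ne_zero_of_mul h2

theorem cornerIntegral_coneIntegrand {a δ η : ℝ} (ha : 0 < a) (hδ : 0 < δ) (hη : 0 < η)
    (haδ : a * δ < Real.pi) (s : ℝ) :
    cornerIntegral δ η (coneIntegrand a s) = 1 / a * (Real.pi * Complex.I) := by
  obtain ⟨σ, τ, dσ, -, hsin, hστ, -⟩ := exists_sin_expansion
  have ha' : (a : ℂ) ≠ 0 := by exact_mod_cast ha.ne'
  have hσ0 : σ 0 = 1 := by simp [hστ]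
  have hne : ∀ z ∈ Icc (-δ) δ ×ℂ Icc (-η) η, σ (a * z) ≠ 0 :=
    fun z hz => ne_zero_of_sin_eq_mul hσ0 hsin ha haδ hz.1
  have dσa : Differentiable ℂ fun z : ℂ => σ (a * z) := dσ.comp (by fun_prop)
  rw [cornerIntegral_of_odd (b := 0)
    (G := fun z => Complex.cos (a * z) * Complex.exp (-s * (1 - Complex.cos z)) / (a * σ (a * z)))
    hδ hη _ (coneIntegrand_neg a s)]
  · simp [hσ0]
  · rintro z ⟨hz, hz0⟩
    have hz0 : z ≠ 0 := hz0
    have := hne z hz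
    rw [coneIntegrand, Complex.cot, hsin]
    field_simp
    simp
  · refine DifferentiableOn.div (by fun_prop) (by fun_prop) fun z hz => ?_
    exact mul_ne_zero ha' (hne z hz)

theorem cornerIntegral_coneWeight {a δ η : ℝ} (ha : 0 < a) (hδ : 0 < δ) (hη : 0 < η)
    (haδ : a * δ < Real.pi) (hδp : δ < Real.pi) :
    cornerIntegral δ η (coneWeight a) = (1 / (6 * a) - 2 * a / 3) * (Real.pi * Complex.I) := by
  obtain ⟨σ, τ, dσ, dτ, hsin, hστ, hτ0⟩ := exists_sin_expansion
  have ha' : (a : ℂ) ≠ 0 := by exact_mod_cast ha.ne'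
  have hσ0 : σ 0 = 1 := by simp [hστ]
  have hne : ∀ z ∈ Icc (-δ) δ ×ℂ Icc (-η) η, σ (a * z) ≠ 0 :=
    fun z hz => ne_zero_of_sin_eq_mul hσ0 hsin ha haδ hz.1
  have hne' : ∀ z ∈ Icc (-δ) δ ×ℂ Icc (-η) η, σ (z / 2) ≠ 0 := fun z hz => by
    have := ne_zero_of_sin_eq_mul (b := 1 / 2) hσ0 hsin (by norm_num) (by linarith) hz.1
    convert this using 2
    push_cast
    ring
  have dσa : Differentiable ℂ fun z : ℂ => σ (a * z) := dσ.comp (by fun_prop)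
  have dσa2 : Differentiable ℂ fun z : ℂ => σ (a * z / 2) := dσ.comp (by fun_prop)
  have dσ2 : Differentiable ℂ fun z : ℂ => σ (z / 2) := dσ.comp (by fun_prop)
  have dτa : Differentiable ℂ fun z : ℂ => τ (a * z) := dτ.comp (by fun_prop)
  have dτ2 : Differentiable ℂ fun z : ℂ => τ (z / 2) := dτ.comp (by fun_prop)
  -- Here `2/(az³)` is the leading term. `G` is the rest of the weight times `z`, with the factor
  -- `z²` cancelled by writing `cos(az)` through `σ(az/2)` and the other factors through `τ`. Its
  -- value at `0` is the residue.
  rw [cornerIntegral_of_odd (b := 2 / a)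
    (G := fun z => 2 * (-a ^ 2 * σ (a * z / 2) ^ 2 / 2
      + a ^ 2 * τ (a * z) * (1 - z ^ 2 * τ (z / 2) / 4) ^ 2 + τ (z / 2) / 2
      - z ^ 2 * τ (z / 2) ^ 2 / 16) / (a * (σ (a * z) * σ (z / 2) ^ 2)))
    hδ hη _ (coneWeight_neg a)]
  · simp only [mul_zero, zero_div, hσ0, hτ0]
    field_simp
    ring
  · rintro z ⟨hz, hz0⟩
    have hz0 : z ≠ 0 := hz0
    have h1 := hne z hz
    have h2 := hne' z hz
    have hcos : Complex.cos (a * z) = 1 - 2 * (a * z / 2 * σ (a * z / 2)) ^ 2 := by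
      rw [← hsin]
      linear_combination -one_sub_cos_eq (a * z)
    have e1 := hστ (a * z)
    have e2 := hστ (z / 2)
    rw [coneWeight, Complex.cot, one_sub_cos_eq, hsin (a * z), hsin (z / 2), hcos]
    generalize σ (a * z / 2) = u
    generalize σ (a * z) = v at *
    generalize σ (z / 2) = w at *
    generalize τ (a * z) = p at *
    generalize τ (z / 2) = q at *
    field_simp
    rw [e1, e2]
    ring
  · refine DifferentiableOn.div (by fun_prop) (by fun_prop) fun z hz => ?_
    exact mul_ne_zero ha' (mul_ne_zero (hne z hz) (pow_ne_zero 2 (hne' z hz)))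

theorem tendsto_integral_coneWeight {a : ℝ} (ha : 0 < a) :
    Tendsto (fun Y : ℝ => ∫ x in -Real.pi..Real.pi, coneWeight a (x + Y * Complex.I)) atTop
      (𝓝 0) := by
  have hb : ∀ᶠ Y : ℝ in atTop, ‖∫ x in -Real.pi..Real.pi, coneWeight a (x + Y * Complex.I)‖
      ≤ (1 + 1 / a) * (1 / Y) * |Real.pi - -Real.pi| := by
    -- For `Y ≥ 2` one has `2 sinh²(Y/2) ≥ Y²/2 ≥ Y`, a crude bound that already forces decay.
    filter_upwards [eventually_ge_atTop 2] with Y hY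
    refine intervalIntegral.norm_integral_le_of_norm_le_const fun x _ => ?_
    have him : (a * (x + Y * Complex.I) : ℂ).im = a * Y := by simp
    have hY0 : 0 < Y := by linarith
    have h1 := norm_cot_le (z := a * (x + Y * Complex.I)) (by rw [him]; positivity)
    have h2 := two_mul_sinh_sq_le_norm_one_sub_cos (z := x + Y * Complex.I) (by simpa using hY0.le)
    have h3 : Y / 2 ≤ Real.sinh (Y / 2) := Real.self_le_sinh_iff.2 (by linarith)
    rw [him] at h1
    simp only [Complex.add_im, Complex.ofReal_im, Complex.mul_im, Complex.ofReal_re,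
      Complex.I_im, mul_one, Complex.I_re, mul_zero, add_zero, zero_add] at h2
    have h4 : Y ≤ ‖1 - Complex.cos (x + Y * Complex.I)‖ := by nlinarith
    have h5 : 1 / (a * Y) ≤ 1 / a := by
      gcongr
      nlinarith
    rw [coneWeight, norm_div, mul_one_div]
    gcongr
    linarith
  refine squeeze_zero_norm' hb ?_
  have : Tendsto (fun Y : ℝ => (1 + 1 / a) * (1 / Y) * |Real.pi - -Real.pi|) atTop
      (𝓝 ((1 + 1 / a) * 0 * |Real.pi - -Real.pi|)) := by
    simp only [one_div]
    exact (tendsto_inv_atTop_zero.const_mul _).mul_const _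
  simpa using this

theorem expIntegrates_coneIntegrand_path {μ : Measure ℝ} [SFinite μ] {γ : ℝ → ℂ}
    (hγ : Continuous γ) (a : ℝ) {c : ℝ} (hc : 0 < c)
    (hwc : ∀ᵐ y ∂μ, c ≤ (1 - Complex.cos (γ y)).re)
    (hint : Integrable (fun y => ‖Complex.cot (a * γ y)‖ / (1 - Complex.cos (γ y)).re) μ) :
    ExpIntegrates (fun s => ∫ y, coneIntegrand a s (γ y) ∂μ) (∫ y, coneWeight a (γ y) ∂μ) :=
  expIntegrates_integral (k := fun y => Complex.cot (a * γ y))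
    (w := fun y => 1 - Complex.cos (γ y)) (measurable_cot.comp (by fun_prop)) (by fun_prop)
    hc hwc hint

theorem expIntegrates_coneIntegrand_segment {γ : ℝ → ℂ} (hγ : Continuous γ) {a : ℝ} {c p q : ℝ}
    (hc : 0 < c) (hwc : ∀ y ∈ Icc p q, c ≤ (1 - Complex.cos (γ y)).re)
    (hsin : ∀ y ∈ Icc p q, Complex.sin (a * γ y) ≠ 0) :
    ExpIntegrates (fun s => ∫ y in Ioc p q, coneIntegrand a s (γ y))
      (∫ y in Ioc p q, coneWeight a (γ y)) := by
  refine expIntegrates_coneIntegrand_path hγ a hc ((ae_restrict_mem measurableSet_Ioc).mono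
    fun y hy => hwc y (Ioc_subset_Icc_self hy)) ?_
  have : ContinuousOn (fun y => ‖Complex.cot (a * γ y)‖ / (1 - Complex.cos (γ y)).re)
      (Icc p q) := by
    refine ContinuousOn.div (ContinuousOn.norm ?_) (Continuous.continuousOn (by fun_prop))
      fun y hy => (hc.trans_le (hwc y hy)).ne'
    simp only [Complex.cot]
    exact ContinuousOn.div (Continuous.continuousOn (by fun_prop))
      (Continuous.continuousOn (by fun_prop)) hsin
  exact this.integrableOn_Icc.mono_set Ioc_subset_Icc_self

theorem one_le_re_ray {c η : ℝ} (hc : Real.cos c = -1) :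
    ∀ᵐ y : ℝ ∂(volume.restrict (Ioi η)), 1 ≤ (1 - Complex.cos (c + y * Complex.I)).re := by
  refine ae_of_all _ fun y => ?_
  rw [one_sub_cos_re, hc]
  linarith [Real.cosh_pos y]

theorem integrableOn_coneIntegrand_ray {a c η s : ℝ} (ha : 0 < a) (hη : 0 < η)
    (hc : Real.cos c = -1) (hs : 0 < s) :
    IntegrableOn (fun y : ℝ => coneIntegrand a s (c + y * Complex.I)) (Ioi η) :=
  integrable_mul_exp_neg_mul (k := fun y : ℝ => Complex.cot (a * (c + y * Complex.I)))
    (w := fun y : ℝ => 1 - Complex.cos (c + y * Complex.I)) (measurable_cot.comp (by fun_prop))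
    (by fun_prop) ((one_le_re_ray hc).mono fun _ h => one_pos.trans_le h)
    (integrable_ray ha hη hc) hs

theorem integrableOn_coneWeight_ray {a c η : ℝ} (ha : 0 < a) (hη : 0 < η)
    (hc : Real.cos c = -1) :
    IntegrableOn (fun y : ℝ => coneWeight a (c + y * Complex.I)) (Ioi η) :=
  integrable_div_of_norm_div_re (k := fun y : ℝ => Complex.cot (a * (c + y * Complex.I)))
    (w := fun y : ℝ => 1 - Complex.cos (c + y * Complex.I)) (measurable_cot.comp (by fun_prop))
    (by fun_prop) ((one_le_re_ray hc).mono fun _ h => one_pos.trans_le h)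
    (integrable_ray ha hη hc)

/-- Since `Re(1 - cos(x + iy)) = 1 - cos x cosh y`, the real part is at least `1` on the rays and at
least `1 - cos δ cosh η > 0` on the three segments. The condition `aδ < π` keeps the vertical
segment off the poles of `cot(az)`. -/
theorem expIntegrates_outerContour {a δ η : ℝ} (ha : 0 < a) (hδ : 0 < δ) (hη : 0 < η)
    (haδ : a * δ < Real.pi) (hδp : δ ≤ Real.pi / 2) (hδη : Real.cos δ * Real.cosh η < 1) :
    ExpIntegrates (fun s => outerContour δ η (coneIntegrand a s))
      (outerContour δ η (coneWeight a)) := by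
  have hray : ∀ c, Real.cos c = -1 →
      ExpIntegrates (fun s => ∫ y in Ioi η, coneIntegrand a s (c + y * Complex.I))
        (∫ y in Ioi η, coneWeight a (c + y * Complex.I)) := fun c hc =>
    expIntegrates_coneIntegrand_path (by fun_prop) a one_pos (one_le_re_ray hc)
      (integrable_ray ha hη hc)
  have hc0 : 0 < 1 - Real.cos δ * Real.cosh η := by linarith
  have hhor : ∀ p q, (∀ x ∈ Icc p q, Real.cos x ≤ Real.cos δ) →
      ExpIntegrates (fun s => ∫ x in Ioc p q, coneIntegrand a s (x + η * Complex.I))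
        (∫ x in Ioc p q, coneWeight a (x + η * Complex.I)) := fun p q hpq => by
    refine expIntegrates_coneIntegrand_segment (by fun_prop) hc0 (fun x hx => ?_) fun x _ => ?_
    · rw [one_sub_cos_re]
      have := mul_le_mul_of_nonneg_right (hpq x hx) (Real.cosh_pos η).le
      linarith
    · exact sin_ne_zero_of_im_ne_zero (im_real_mul_ne_zero ha (by simpa using hη))
  have hver : ExpIntegrates (fun s => ∫ y in Ioc (-η) η, coneIntegrand a s (δ + y * Complex.I))
      (∫ y in Ioc (-η) η, coneWeight a (δ + y * Complex.I)) := by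
    refine expIntegrates_coneIntegrand_segment (by fun_prop) hc0 (fun y hy => ?_) fun y _ => ?_
    · rw [one_sub_cos_re]
      have h1 : Real.cosh y ≤ Real.cosh η := by
        rw [Real.cosh_le_cosh, abs_of_pos hη]
        exact abs_le.2 hy
      have h2 : 0 ≤ Real.cos δ := Real.cos_nonneg_of_mem_Icc ⟨by linarith, hδp⟩
      have := mul_le_mul_of_nonneg_left h1 h2
      linarith
    · have hre : (a * (δ + y * Complex.I) : ℂ).re = a * δ := by simp
      have hp : 0 < a * δ := mul_pos ha hδ
      refine sin_ne_zero_of_abs_re_lt_pi (fun h => ?_) ?_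
      · rw [h] at hre
        exact hp.ne hre
      · rwa [hre, abs_of_pos hp]
  have hl := hray (-Real.pi) (by simp)
  have hr := hray Real.pi (by simp)
  simp only [Complex.ofReal_neg] at hl
  refine ((((hl.const_mul _).add (hr.const_mul _)).add ((hhor _ _ fun x hx => ?_).const_mul _)).add
    ((hhor _ _ fun x hx => ?_).const_mul _)).add (hver.const_mul _)
  · rw [← Real.cos_neg x]
    exact Real.cos_le_cos_of_nonneg_of_le_pi hδ.le (by linarith [hx.1]) (by linarith [hx.2])
  · exact Real.cos_le_cos_of_nonneg_of_le_pi hδ.le hx.2 hx.1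

/-- First `δ` is fixed, with `cos δ < 1`; then `η` is taken small, as `cosh η → 1`. The bound `η ≤
1` allows the contour at height `1` to be lowered to `η`. -/
theorem exists_contour_parameters {a : ℝ} (ha : 0 < a) : ∃ δ η : ℝ, 0 < δ ∧ 0 < η ∧
    a * δ < Real.pi ∧ δ ≤ Real.pi / 2 ∧ η ≤ 1 ∧ Real.cos δ * Real.cosh η < 1 := by
  have hpi := Real.pi_pos
  set δ := min (Real.pi / 2) (Real.pi / (2 * a)) with hδ
  have hδ0 : 0 < δ := lt_min (by positivity) (by positivity)
  have hδ1 : δ ≤ Real.pi / 2 := min_le_left _ _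
  have hδ2 : δ ≤ Real.pi / (2 * a) := min_le_right _ _
  have hcos : Real.cos δ < 1 := by
    rw [← Real.cos_zero]
    exact Real.cos_lt_cos_of_nonneg_of_le_pi le_rfl (by linarith) hδ0
  have ht : Tendsto (fun η => Real.cos δ * Real.cosh η) (𝓝[>] 0)
      (𝓝 (Real.cos δ * Real.cosh 0)) :=
    ((Real.continuous_cosh.const_mul _).tendsto 0).mono_left nhdsWithin_le_nhds
  rw [Real.cosh_zero, mul_one] at ht
  obtain ⟨η, h1, h2⟩ := ((ht.eventually_lt_const hcos).and
    (Ioo_mem_nhdsGT (zero_lt_one' ℝ))).exists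
  refine ⟨δ, η, hδ0, h2.1, ?_, hδ1, h2.2.le, h1⟩
  calc a * δ ≤ a * (Real.pi / (2 * a)) := by gcongr
    _ = Real.pi / 2 := by field_simp
    _ < Real.pi := by linarith

/-- Removing both half residues leaves twice the outer integral. Its limit is evaluated by the same
splitting applied to the weight, whose full upper contour integral is zero. -/
theorem expIntegrates_contourIntegralA {a : ℝ} (ha : 0 < a) :
    ExpIntegrates (fun s => contourIntegralA 0 (coneIntegrand a s) - 2 * Real.pi * Complex.I / a)
      (-2 * Real.pi * Complex.I * (1 / (6 * a) - 2 * a / 3)) := by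
  obtain ⟨δ, η, hδ, hη, haδ, hδp, hη1, hδη⟩ := exists_contour_parameters ha
  have hpi := Real.pi_pos
  have hcpi : Real.cos Real.pi = -1 := Real.cos_pi
  have hcpi' : Real.cos (-Real.pi) = -1 := by simp
  refine ((expIntegrates_outerContour ha hδ hη haδ hδp hδη).const_mul 2).congr
    (fun s hs => ?_) ?_
  · have hF : ∀ z : ℂ, 0 < z.im → DifferentiableAt ℂ (coneIntegrand a s) z :=
      fun z hz => differentiableAt_coneIntegrand ha s hz
    have hl := integrableOn_coneIntegrand_ray ha hη hcpi' hs
    have hr := integrableOn_coneIntegrand_ray ha hη hcpi hs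
    simp only [Complex.ofReal_neg] at hl
    rw [contourIntegralA_zero_of_odd (coneIntegrand_neg a s), upperContour_eq hF hη hη1 hl hr,
      upperContour_eq_outerContour_add (δ := δ) hF hη (by linarith) hl hr,
      cornerIntegral_coneIntegrand ha hδ hη haδ]
    ring
  · have hF : ∀ z : ℂ, 0 < z.im → DifferentiableAt ℂ (coneWeight a) z :=
      fun z hz => differentiableAt_coneWeight ha hz
    have hl := integrableOn_coneWeight_ray ha hη hcpi'
    have hr := integrableOn_coneWeight_ray ha hη hcpi
    simp only [Complex.ofReal_neg] at hl
    have h := upperContour_eq_outerContour_add (δ := δ) hF hη (by linarith) hl hr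
    rw [upperContour_eq_zero hF hη hl hr (tendsto_integral_coneWeight ha),
      cornerIntegral_coneWeight ha hδ hη haδ (by linarith)] at h
    linear_combination -2 * h

theorem contourIntegralA_const_mul (θ : ℝ) (c : ℂ) (F : ℂ → ℂ) :
    contourIntegralA θ (fun z => c * F z) = c * contourIntegralA θ F := by
  simp only [contourIntegralA, ← mul_sub, integral_const_mul, intervalIntegral.integral_const_mul]
  ring

/-- On the diagonal the heat kernel depends on `r` only. -/
theorem heatKernelPolar_diag (β r θ t : ℝ) :
    heatKernelPolar β r θ r θ t = 1 / (8 * Real.pi * β * Complex.I * t) *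
      contourIntegralA 0 (coneIntegrand (Real.pi / β) (r ^ 2 / (2 * t))) := by
  rw [heatKernelPolar, mul_assoc, ← contourIntegralA_const_mul, ← zero_add θ,
    contourIntegralA_add]
  congr 2
  funext z
  rw [coneIntegrand, ← mul_assoc, ← Complex.exp_add, mul_comm]
  congr 2
  · push_cast
    ring
  · push_cast
    ring_nf

/-! ### Radial integration on the cone -/

namespace Cone

theorem measurable_radius (β : ℝ) : Measurable (radius : Cone β → ℝ) := by
  refine measurable_from_quotient.2 ?_
  have h : (radius : Cone β → ℝ) ∘ Quotient.mk'' = fun p : ℝ≥0 × AddCircle β => (p.1 : ℝ) := by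
    funext p
    have h := Quotient.mk_out (s := coneSetoid β) p
    change ((Quotient.out (Quotient.mk (coneSetoid β) p)).1 : ℝ) = p.1
    rcases h with h | ⟨h, h'⟩
    · rw [h]
    · rw [h, h']
  exact h ▸ measurable_fst.coe_nnreal_real

theorem measurable_polar (β : ℝ) : Measurable (polar β) := by
  have h : Measurable fun p : ℝ × ℝ => ((p.1.toNNReal, (p.2 : AddCircle β)) : ℝ≥0 × AddCircle β) :=
    measurable_fst.real_toNNReal.prodMk (AddCircle.measurable_mk'.comp measurable_snd)
  exact (measurable_quotient_mk' (s := coneSetoid β)).comp h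

theorem disk_eq_preimage (β R : ℝ) : disk β R = radius ⁻¹' Iio R := by
  ext x
  simp [disk, dist_vertex]

/-- The angular variable integrates out to the factor `β`, leaving `β r dr` on `(0, R)`. -/
theorem map_radius_area_restrict_disk {β : ℝ} (R : ℝ) :
    ((area β).restrict (disk β R)).map radius = ENNReal.ofReal β •
      (volume.restrict (Ioo 0 R)).withDensity ENNReal.ofReal := by
  have h1 : (area β).map radius = ENNReal.ofReal β •
      (volume.restrict (Ioi 0)).withDensity ENNReal.ofReal := by
    rw [area, Measure.map_map (measurable_radius β) (measurable_polar β), Measure.volume_eq_prod,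
      ← Measure.prod_restrict]
    have h2 : ((volume.restrict (Ioi (0 : ℝ))).prod (volume.restrict (Ico 0 β))).withDensity
        (fun p => ENNReal.ofReal p.1) = ((volume.restrict (Ioi (0 : ℝ))).withDensity
          ENNReal.ofReal).prod (volume.restrict (Ico 0 β)) :=
      (prod_withDensity_left (by fun_prop)).symm
    have h3 : radius ∘ polar β =ᵐ[((volume.restrict (Ioi (0 : ℝ))).prod
        (volume.restrict (Ico 0 β))).withDensity (fun p => ENNReal.ofReal p.1)] Prod.fst := by
      refine (withDensity_absolutelyContinuous _ _).ae_le ?_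
      rw [Measure.prod_restrict]
      refine (ae_restrict_mem (measurableSet_Ioi.prod measurableSet_Ico)).mono fun p hp => ?_
      exact radius_polar (le_of_lt hp.1) p.2
    rw [Measure.map_congr h3, h2, Measure.map_fst_prod]
    simp
  rw [disk_eq_preimage, ← Measure.restrict_map (measurable_radius β) measurableSet_Iio, h1,
    Measure.restrict_smul, restrict_withDensity measurableSet_Iio,
    Measure.restrict_restrict measurableSet_Iio, inter_comm, Ioi_inter_Iio]

theorem area_disk {β R : ℝ} (hβ : 0 < β) (hR : 0 < R) :
    area β (disk β R) = ENNReal.ofReal (β * (R ^ 2 / 2)) := by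
  have h := congrArg (fun μ => μ univ) (map_radius_area_restrict_disk (β := β) R)
  simp only [Measure.map_apply (measurable_radius β) MeasurableSet.univ, preimage_univ,
    Measure.restrict_apply_univ, Measure.smul_apply, smul_eq_mul,
    withDensity_apply _ MeasurableSet.univ, Measure.restrict_univ] at h
  rw [h, ← ofReal_integral_eq_lintegral_ofReal, ← integral_Ioc_eq_integral_Ioo,
    ← intervalIntegral.integral_of_le hR.le, integral_id, ← ENNReal.ofReal_mul hβ.le]
  · simp
  · exact continuous_id.integrableOn_Icc.mono_set Ioo_subset_Icc_self
  · exact (ae_restrict_mem measurableSet_Ioo).mono fun r hr => hr.1.le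

/-- Multiplying by `1/r` recovers `f` on `(0, R)`, so integrability of `r f(r)` is the only
hypothesis needed below. -/
theorem aestronglyMeasurable_of_mul {R : ℝ} {f : ℝ → ℂ}
    (hf : IntegrableOn (fun r : ℝ => (r : ℂ) * f r) (Ioo 0 R)) :
    AEStronglyMeasurable f (volume.restrict (Ioo 0 R)) := by
  have h : AEStronglyMeasurable (fun r : ℝ => (r : ℂ)⁻¹) (volume.restrict (Ioo 0 R)) :=
    (Complex.measurable_ofReal.inv).aestronglyMeasurable
  refine (h.mul hf.aestronglyMeasurable).congr ?_
  refine (ae_restrict_mem measurableSet_Ioo).mono fun r hr => ?_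
  have : (r : ℂ) ≠ 0 := by exact_mod_cast hr.1.ne'
  simp [this]

theorem aestronglyMeasurable_map_radius (β : ℝ) {R : ℝ} {f : ℝ → ℂ}
    (hf : IntegrableOn (fun r : ℝ => (r : ℂ) * f r) (Ioo 0 R)) :
    AEStronglyMeasurable f (((area β).restrict (disk β R)).map radius) := by
  rw [map_radius_area_restrict_disk]
  exact (aestronglyMeasurable_of_mul hf).mono_ac
    (Measure.smul_absolutelyContinuous.trans (withDensity_absolutelyContinuous _ _))

theorem integrableOn_comp_radius (β : ℝ) {R : ℝ} {f : ℝ → ℂ}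
    (hf : IntegrableOn (fun r : ℝ => (r : ℂ) * f r) (Ioo 0 R)) :
    IntegrableOn (fun x : Cone β => f x.radius) (disk β R) (area β) := by
  refine (integrable_map_measure (aestronglyMeasurable_map_radius β hf)
    (measurable_radius β).aemeasurable).1 ?_
  rw [map_radius_area_restrict_disk]
  refine Integrable.smul_measure ?_ ENNReal.ofReal_ne_top
  rw [integrable_withDensity_iff_integrable_smul' ENNReal.measurable_ofReal (by simp)]
  refine hf.congr ((ae_restrict_mem measurableSet_Ioo).mono fun r hr => ?_)
  simp [ENNReal.toReal_ofReal hr.1.le]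

theorem integral_comp_radius {β R : ℝ} (hβ : 0 < β) {f : ℝ → ℂ}
    (hf : IntegrableOn (fun r : ℝ => (r : ℂ) * f r) (Ioo 0 R)) :
    ∫ x in disk β R, f x.radius ∂(area β) = β * ∫ r in Ioo 0 R, (r : ℂ) * f r := by
  rw [← integral_map (f := f) (measurable_radius β).aemeasurable
    (aestronglyMeasurable_map_radius β hf), map_radius_area_restrict_disk, integral_smul_measure,
    integral_withDensity_eq_integral_toReal_smul ENNReal.measurable_ofReal (by simp),
    ENNReal.toReal_ofReal hβ.le, Complex.real_smul]
  congr 1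
  refine setIntegral_congr_fun measurableSet_Ioo fun r hr => ?_
  simp [ENNReal.toReal_ofReal hr.1.le]

end Cone

/-! ### The substitution `s = r²/(2t)` and the asymptotics -/

theorem image_sq_div_Ioo {R t : ℝ} (hR : 0 < R) (ht : 0 < t) :
    (fun r => r ^ 2 / (2 * t)) '' Ioo 0 R = Ioo 0 (R ^ 2 / (2 * t)) := by
  ext y
  constructor
  · rintro ⟨r, ⟨h1, h2⟩, rfl⟩
    refine ⟨by positivity, ?_⟩
    dsimp only
    gcongr
  · rintro ⟨h1, h2⟩
    rw [lt_div_iff₀ (by positivity)] at h2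
    refine ⟨√(y * (2 * t)), ⟨by positivity, ?_⟩, ?_⟩
    · rwa [Real.sqrt_lt' hR]
    · dsimp only
      rw [Real.sq_sqrt (by positivity)]
      field_simp

theorem integrableOn_and_integral_comp_sq_div {R t : ℝ} (hR : 0 < R) (ht : 0 < t) {φ : ℝ → ℂ}
    (hφ : IntegrableOn φ (Ioc 0 (R ^ 2 / (2 * t)))) :
    IntegrableOn (fun r : ℝ => (r : ℂ) * φ (r ^ 2 / (2 * t))) (Ioo 0 R) ∧
      ∫ r in Ioo 0 R, (r : ℂ) * φ (r ^ 2 / (2 * t)) = t * ∫ s in Ioc 0 (R ^ 2 / (2 * t)), φ s := by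
  have hd : ∀ r ∈ Ioo 0 R, HasDerivWithinAt (fun r => r ^ 2 / (2 * t)) (r / t) (Ioo 0 R) r :=
    fun r _ => by
      refine (((hasDerivAt_pow 2 r).div_const (2 * t)).congr_deriv ?_).hasDerivWithinAt
      simp
      field_simp
  have hinj : InjOn (fun r => r ^ 2 / (2 * t)) (Ioo 0 R) := by
    intro x hx y hy h
    have : x ^ 2 = y ^ 2 := by
      dsimp only at h
      field_simp at h
      exact h
    exact (sq_eq_sq₀ hx.1.le hy.1.le).1 this
  have heq : EqOn (fun r : ℝ => t * (|r / t| • φ (r ^ 2 / (2 * t))))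
      (fun r : ℝ => (r : ℂ) * φ (r ^ 2 / (2 * t))) (Ioo 0 R) := fun r hr => by
    have ht' : (t : ℂ) ≠ 0 := by exact_mod_cast ht.ne'
    have := hr.1
    dsimp only
    rw [abs_of_pos (by positivity), Complex.real_smul]
    push_cast
    field_simp
  have h1 := (integrableOn_image_iff_integrableOn_abs_deriv_smul measurableSet_Ioo hd hinj φ).1
    (by rw [image_sq_div_Ioo hR ht]; exact hφ.mono_set Ioo_subset_Ioc_self)
  have h2 := integral_image_eq_integral_abs_deriv_smul measurableSet_Ioo hd hinj φ
  rw [image_sq_div_Ioo hR ht] at h2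
  constructor
  · exact IntegrableOn.congr_fun (h1.const_mul (t : ℂ)) heq measurableSet_Ioo
  · rw [← setIntegral_congr_fun measurableSet_Ioo heq, integral_const_mul, ← h2,
      integral_Ioc_eq_integral_Ioo]

theorem mainTheorem12 (β R : ℝ) (hβ : 0 < β) (hR : 0 < R) :
    Cone.area β (Cone.disk β R) < ⊤ ∧
    (∀ t : ℝ, 0 < t →
      IntegrableOn (fun x => heatKernel β x x t) (Cone.disk β R) (Cone.area β)) ∧
    ∃ ε : ℝ, 0 < ε ∧
      (fun t : ℝ => (∫ x in Cone.disk β R, heatKernel β x x t ∂(Cone.area β))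
        - (((Cone.area β).real (Cone.disk β R) / (4 * Real.pi * t)
            + 1 / 12 * (2 * Real.pi / β - β / (2 * Real.pi)) : ℝ) : ℂ))
        =O[𝓝[>] (0 : ℝ)] (fun t : ℝ => Real.exp (-ε / t)) := by
  have hpi := Real.pi_pos
  have hpi' : (Real.pi : ℂ) ≠ 0 := by exact_mod_cast hpi.ne'
  have hβ' : (β : ℂ) ≠ 0 := by exact_mod_cast hβ.ne'
  have hA : (Cone.area β).real (Cone.disk β R) = β * (R ^ 2 / 2) := by
    rw [Measure.real, Cone.area_disk hβ hR, ENNReal.toReal_ofReal (by positivity)]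
  obtain ⟨hint, c, hc, C, hC⟩ := expIntegrates_contourIntegralA (div_pos hpi hβ)
  set φ : ℝ → ℂ := fun s => contourIntegralA 0 (coneIntegrand (Real.pi / β) s) with hφ
  set m : ℂ := 2 * Real.pi * Complex.I / ((Real.pi / β : ℝ) : ℂ) with hm
  have hconst : ∀ S : ℝ, IntegrableOn (fun _ => m) (Ioc 0 S) := fun S =>
    integrableOn_const (by simp)
  have hφint : ∀ S, 0 < S → IntegrableOn φ (Ioc 0 S) := fun S hS => by
    refine ((hint S hS).add (hconst S)).congr_fun (fun s _ => ?_) measurableSet_Ioc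
    simp [hφ]
  -- With `S = R²/(2t)`, the term `S m / (8πi)` equals `βR²/(8πt)`, the area term.
  have hφeq : ∀ S, 0 < S → ∫ s in Ioc 0 S, φ s = (∫ s in Ioc 0 S, (φ s - m)) + S * m :=
    fun S hS => by
      rw [integral_sub (hφint S hS) (hconst S)]
      simp [hS.le]
  have hker : ∀ t, (fun x : Cone β => heatKernel β x x t) = fun x =>
      (fun r : ℝ => 1 / (8 * Real.pi * β * Complex.I * t) * φ (r ^ 2 / (2 * t))) x.radius :=
    fun t => by
      funext x
      exact heatKernelPolar_diag β x.radius x.angle t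
  have hrad : ∀ t, 0 < t → IntegrableOn (fun r : ℝ => (r : ℂ) *
      (1 / (8 * Real.pi * β * Complex.I * t) * φ (r ^ 2 / (2 * t)))) (Ioo 0 R) := fun t ht => by
    simp only [mul_left_comm _ (1 / (8 * Real.pi * β * Complex.I * t) : ℂ)]
    exact (integrableOn_and_integral_comp_sq_div hR ht
      (hφint _ (by positivity))).1.const_mul _
  refine ⟨by rw [Cone.area_disk hβ hR]; exact ENNReal.ofReal_lt_top, fun t ht => ?_,
    -- This rate makes `e^{-ε/t}` equal to `e^{-cS}` at `S = R²/(2t)`.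
    c * R ^ 2 / 2, by positivity, ?_⟩
  · rw [hker]
    exact Cone.integrableOn_comp_radius β (hrad t ht)
  · refine IsBigO.of_bound (‖1 / (8 * Real.pi * Complex.I)‖ * C) ?_
    filter_upwards [self_mem_nhdsWithin] with t ht
    have ht : 0 < t := ht
    have ht' : (t : ℂ) ≠ 0 := by exact_mod_cast ht.ne'
    have hS : 0 < R ^ 2 / (2 * t) := by positivity
    have h := hC _ hS
    have hval : ∫ x in Cone.disk β R, heatKernel β x x t ∂(Cone.area β)
        = 1 / (8 * Real.pi * Complex.I) * ∫ s in Ioc 0 (R ^ 2 / (2 * t)), φ s := by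
      rw [hker, Cone.integral_comp_radius hβ (hrad t ht)]
      simp only [mul_left_comm _ (1 / (8 * Real.pi * β * Complex.I * t) : ℂ)]
      rw [integral_const_mul, (integrableOn_and_integral_comp_sq_div hR ht (hφint _ hS)).2]
      field_simp
    rw [hval, hφeq _ hS, hA]
    have hexp : Real.exp (-c * (R ^ 2 / (2 * t))) = Real.exp (-(c * R ^ 2 / 2) / t) := by
      congr 1
      field_simp
    rw [hexp] at h
    rw [Real.norm_of_nonneg (Real.exp_pos _).le]
    refine le_trans (le_of_eq ?_) ((mul_le_mul_of_nonneg_left h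
      (norm_nonneg (1 / (8 * Real.pi * Complex.I)))).trans_eq (mul_assoc _ _ _).symm)
    rw [← norm_mul]
    congr 1
    rw [hm]
    push_cast
    field_simp
    ring
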